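/- Let $\mathcal H$ be a complex Hilbert space, let $m\ge 1$, and let $\mathbf A=(A_1,\dots,A_m)$ be an $m$-tuple of bounded self-adjoint operators on $\mathcal H$. For a positive integer $k$, let the joint $k$-numerical range of $\mathbf A$ be $$W_k(\mathbf A)=\Big\{\Big(\sum_{\ell=1}^k\langle A_1x_\ell,x_\ell\rangle,\dots,\sum_{\ell=1}^k\langle A_mx_\ell,x_\ell\rangle\Big) : \{x_1,\dots,x_k\}\subseteq\mathcal H \text{ is an orthonormal set of $k$ vectors}\Big\}\subseteq\mathbb R^m\subseteq\mathbb C^m$$ (empty if $k>\dim\mathcal H$), and let $\operatorname{conv}$ denote the convex hull. Then, for every positive integer $k$: 1. If $m\le 3$ and $W_{k+1}(\mathbf A)$ is closed, then $W_k(\mathbf A)$ is closed. 2. For every $m$, if $W_{k+1}(\mathbf A)$ is closed or $\operatorname{conv} W_{k+1}(\mathbf A)$ is closed, then $\operatorname{conv} W_k(\mathbf A)$ is closed. -/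

import Mathlib

/-- The joint `k`-numerical range of a tuple `A = (A₁, …, Aₘ)` of bounded linear operators on a
complex Hilbert space: the set of all points `(∑ₗ ⟨A₁ xₗ, xₗ⟩, …, ∑ₗ ⟨Aₘ xₗ, xₗ⟩)` of `ℂᵐ`, where
`x₁, …, xₖ` runs over the orthonormal families of `k` vectors. (Mathlib's inner product is linear in
its second argument.) -/
def jointNumericalRange {H : Type*} [NormedAddCommGroup H] [InnerProductSpace ℂ H]
    {m : ℕ} (k : ℕ) (A : Fin m → (H →L[ℂ] H)) : Set (Fin m → ℂ) :=
  {a | ∃ x : Fin k → H, Orthonormal ℂ x ∧ ∀ j, a j = ∑ l, inner ℂ (x l) (A j (x l))}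

open Filter Topology

/-! Write `q` for `quadTuple A`, and let `W` and `W'` be the ranges of orders `k + 1` and `k + 2`.
The hull of `closure W` is compact, hence the hull of its extreme points, so it suffices to put each
extreme point `v` into `conv W`.

Take orthonormal tuples whose values tend to `v`. After a rotation, either they converge strongly
and `v ∈ W`, or some vector loses mass to a part escaping weakly to zero. The normalized limit value
`e` of that part can be adjoined to any orthonormal tuple, up to closure. Extremality then lets `e`
account for the whole vector, so `v + e ∈ closure W'`, and `v - e + q y ∈ closure W` for every unit
`y` orthogonal to the weak limits (`mem_or_exists_of_mem_extremePoints`).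

If `conv W'` is closed, it contains `v + e`. Every orthonormal `(k + 2)`-tuple can be rotated to
contain such a `y`; averaging gives `d ∈ conv W` with `2v - d ∈ conv (closure W)`. As `v` is the
midpoint of these two points, `v = d`.

For `m ≤ 3` the range is convex in infinite dimension (`convex_jointNumericalRange`) and compact in
finite dimension. -/

/-! ### Convex hulls and extreme points in finite dimension -/

theorem IsCompact.convexHull_of_finiteDimensional {E : Type*} [NormedAddCommGroup E]
    [NormedSpace ℝ E] [FiniteDimensional ℝ E] {K : Set E} (hK : IsCompact K) :
    IsCompact (convexHull ℝ K) := by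
  -- Carathéodory: at most `finrank + 1` points suffice, so the hull is a finite union of continuous
  -- images of compact sets.
  have heq : convexHull ℝ K = ⋃ n ∈ Finset.range (Module.finrank ℝ E + 2),
      (fun p : (Fin n → ℝ) × (Fin n → E) => ∑ i, p.1 i • p.2 i) ''
        (stdSimplex ℝ (Fin n) ×ˢ Set.univ.pi fun _ => K) := by
    refine Set.Subset.antisymm (fun x hx => ?_) ?_
    · obtain ⟨ι, _, z, w, hz, haff, hw, hw1, rfl⟩ := eq_pos_convex_span_of_mem_convexHull hx
      have hcard : Fintype.card ι ≤ Module.finrank ℝ E + 1 :=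
        haff.card_le_finrank_succ.trans (by gcongr; exact Submodule.finrank_le _)
      let e := (Fintype.equivFin ι).symm
      refine Set.mem_biUnion (Finset.mem_coe.2 (Finset.mem_range.2 (Nat.lt_succ_of_le hcard)))
        ⟨(w ∘ e, z ∘ e), ⟨⟨fun i => (hw _).le, ?_⟩, fun i _ => hz ⟨_, rfl⟩⟩, ?_⟩
      · simpa using (e.sum_comp w).trans hw1
      · exact e.sum_comp fun i => w i • z i
    · simp only [Set.iUnion_subset_iff, Set.image_subset_iff]
      rintro n - ⟨w, z⟩ ⟨⟨hw, hw1⟩, hz⟩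
      exact (convex_convexHull ℝ K).sum_mem (fun i _ => hw i) hw1
        fun i _ => subset_convexHull ℝ K (hz i trivial)
  rw [heq]
  refine Finset.isCompact_biUnion _ fun n _ => IsCompact.image
    ((isCompact_stdSimplex ℝ (Fin n)).prod (isCompact_univ_pi fun _ => hK)) ?_
  fun_prop

/-- Lift `K` to the graph of `f`. By strict convexity, a graph point over a non-extreme point can be
raised inside the hull `convexHull ℝ L`. The highest point of that hull over `x` cannot be raised,
so it lies in the hull of the graph over the extreme points. -/
theorem IsCompact.subset_convexHull_extremePoints {E : Type*} [NormedAddCommGroup E]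
    [NormedSpace ℝ E] [FiniteDimensional ℝ E] {K : Set E} (hK : IsCompact K)
    {f : E → ℝ} (hf : Continuous f) (hsc : StrictConvexOn ℝ Set.univ f) :
    K ⊆ convexHull ℝ (K.extremePoints ℝ) := by
  intro x hx
  set L : Set (E × ℝ) := (fun p => (p, f p)) '' K with hL
  have hLc : IsCompact (convexHull ℝ L) := (hK.image (f := fun p => (p, f p)) (by fun_prop)).convexHull_of_finiteDimensional
  obtain ⟨⟨x', s⟩, ⟨hs, hxs⟩, hmax⟩ := (hLc.inter_right
      (isClosed_eq continuous_fst (continuous_const (y := x)))).exists_isMaxOn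
    ⟨(x, f x), subset_convexHull ℝ L ⟨x, hx, rfl⟩, rfl⟩ continuous_snd.continuousOn
  obtain rfl : x' = x := hxs
  set G : Set (E × ℝ) := convexHull ℝ ((fun p => (p, f p)) '' K.extremePoints ℝ) with hG
  set U : Set (E × ℝ) := {q ∈ convexHull ℝ L | ∃ δ : ℝ, 0 < δ ∧ q + (0, δ) ∈ convexHull ℝ L}
    with hU
  have hGL : G ⊆ convexHull ℝ L :=
    convexHull_mono (Set.image_mono extremePoints_subset)
  have hcL := convex_convexHull ℝ L
  have key : ∀ q ∈ U, ∀ p ∈ convexHull ℝ L, ∀ a b : ℝ, 0 < a → 0 ≤ b → a + b = 1 →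
      a • q + b • p ∈ U := by
    rintro q ⟨hq, δ, hδ, hqδ⟩ p hp a b ha hb hab
    refine ⟨hcL hq hp ha.le hb hab, a * δ, by positivity, ?_⟩
    have := hcL hqδ hp ha.le hb hab
    convert this using 1
    ext <;> simp; ring
  -- A combination giving positive weight to a raisable point is raisable.
  have hconv : Convex ℝ (G ∪ U) := by
    intro p hp q hq a b ha hb hab
    have hpL : p ∈ convexHull ℝ L := hp.elim (fun h => hGL h) (fun h => h.1)
    have hqL : q ∈ convexHull ℝ L := hq.elim (fun h => hGL h) (fun h => h.1)
    rcases ha.eq_or_lt with rfl | ha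
    · obtain rfl : b = 1 := by linarith
      simpa using hq
    rcases hb.eq_or_lt with rfl | hb
    · obtain rfl : a = 1 := by linarith
      simpa using hp
    rcases hp with hp | hp
    · rcases hq with hq | hq
      · exact Or.inl (convex_convexHull ℝ _ hp hq ha.le hb.le hab)
      · right
        rw [add_comm]
        exact key q hq p hpL b a hb ha.le (by linarith)
    · exact Or.inr (key p hp q hqL a b ha hb.le hab)
  have hsub : L ⊆ G ∪ U := by
    rintro _ ⟨p, hp, rfl⟩
    by_cases hpe : p ∈ K.extremePoints ℝ
    · exact Or.inl (subset_convexHull ℝ _ ⟨p, hpe, rfl⟩)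
    right
    refine ⟨subset_convexHull ℝ _ ⟨p, hp, rfl⟩, ?_⟩
    have : ∃ y ∈ K, ∃ z ∈ K, p ∈ openSegment ℝ y z ∧ y ≠ z := by
      by_contra! h
      refine hpe ⟨hp, fun y hy z hz hpo => ?_⟩
      obtain rfl := h y hy z hz hpo
      obtain ⟨a, b, -, -, hab, h⟩ := hpo
      rwa [← add_smul, hab, one_smul] at h
    obtain ⟨y, hy, z, hz, ⟨a, b, ha, hb, hab, rfl⟩, hyz⟩ := this
    have hlt := hsc.2 (Set.mem_univ y) (Set.mem_univ z) hyz ha hb hab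
    refine ⟨a • f y + b • f z - f (a • y + b • z), by linarith, ?_⟩
    convert hcL (subset_convexHull ℝ L ⟨y, hy, rfl⟩) (subset_convexHull ℝ L ⟨z, hz, rfl⟩)
      ha.le hb.le hab using 1
    ext <;> simp
  rcases convexHull_min hsub hconv hs with h | ⟨-, δ, hδ, h⟩
  · have := Set.mem_image_of_mem (LinearMap.fst ℝ E ℝ) h
    rw [hG, (LinearMap.fst ℝ E ℝ).image_convexHull, Set.image_image] at this
    simpa using this
  · have := hmax (a := (x', s) + (0, δ)) ⟨h, by simp⟩
    simp at this
    linarith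

theorem strictConvexOn_sum_norm_sq {ι : Type*} [Fintype ι] :
    StrictConvexOn ℝ Set.univ (fun p : ι → ℂ => ∑ i, ‖p i‖ ^ 2) := by
  refine ⟨convex_univ, fun x _ y _ hxy a b ha hb hab => ?_⟩
  have h : ∀ i, ‖(a • x + b • y) i‖ ^ 2 + a * b * ‖x i - y i‖ ^ 2
      = a * ‖x i‖ ^ 2 + b * ‖y i‖ ^ 2 := by
    intro i
    obtain rfl : b = 1 - a := by linarith
    simp only [← Complex.normSq_eq_norm_sq, Complex.normSq_apply]
    simp
    ring
  obtain ⟨i, hi⟩ := Function.ne_iff.1 hxy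
  simp only [smul_eq_mul, Finset.mul_sum, ← Finset.sum_add_distrib]
  refine Finset.sum_lt_sum (fun j _ => ?_) ⟨i, Finset.mem_univ _, ?_⟩
  · rw [← h j]
    have : 0 ≤ a * b * ‖x j - y j‖ ^ 2 := by positivity
    linarith
  · rw [← h i]
    have : 0 < ‖x i - y i‖ := norm_pos_iff.2 (sub_ne_zero.2 hi)
    have : 0 < a * b * ‖x i - y i‖ ^ 2 := by positivity
    linarith

/-! ### Quadratic forms on orthonormal tuples and weak limits -/

section
variable {H : Type*} [NormedAddCommGroup H] [InnerProductSpace ℂ H] {m k : ℕ}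

/-- The tuple of quadratic forms `x ↦ (⟨x, A₁ x⟩, …, ⟨x, Aₘ x⟩)`. -/
noncomputable def quadTuple (A : Fin m → (H →L[ℂ] H)) (x : H) : Fin m → ℂ :=
  fun j => inner ℂ x (A j x)

theorem mem_jointNumericalRange {A : Fin m → (H →L[ℂ] H)} {a : Fin m → ℂ} :
    a ∈ jointNumericalRange k A ↔
      ∃ x : Fin k → H, Orthonormal ℂ x ∧ ∑ l, quadTuple A (x l) = a := by
  simp only [jointNumericalRange, Set.mem_ofPred_eq, funext_iff, Finset.sum_apply, quadTuple]
  simp only [eq_comm]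

theorem quadTuple_smul (A : Fin m → (H →L[ℂ] H)) (c : ℂ) (x : H) :
    quadTuple A (c • x) = ((‖c‖ ^ 2 : ℝ)) • quadTuple A x := by
  ext j
  simp only [quadTuple, map_smul, inner_smul_left, inner_smul_right, Pi.smul_apply,
    Complex.real_smul]
  rw [← mul_assoc, mul_comm c, Complex.conj_mul']
  push_cast
  rfl

theorem continuous_quadTuple (A : Fin m → (H →L[ℂ] H)) : Continuous (quadTuple A) := by
  unfold quadTuple
  fun_prop

/-- The linear map sending the standard basis of `ℂᵏ` to the vectors `x₁, …, xₖ`. -/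
noncomputable def euclideanCombination (x : Fin k → H) : EuclideanSpace ℂ (Fin k) →ₗ[ℂ] H :=
  Fintype.linearCombination ℂ x ∘ₗ (WithLp.linearEquiv 2 ℂ (Fin k → ℂ)).toLinearMap

theorem euclideanCombination_apply (x : Fin k → H) (a : EuclideanSpace ℂ (Fin k)) :
    euclideanCombination x a = ∑ i, a i • x i := by
  simp [euclideanCombination, Fintype.linearCombination_apply]

theorem Orthonormal.inner_euclideanCombination {x : Fin k → H} (hx : Orthonormal ℂ x)
    (a b : EuclideanSpace ℂ (Fin k)) :
    inner ℂ (euclideanCombination x a) (euclideanCombination x b) = inner ℂ a b := by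
  rw [euclideanCombination_apply, euclideanCombination_apply, hx.inner_sum]
  simp [PiLp.inner_apply, mul_comm]

theorem Orthonormal.norm_euclideanCombination {x : Fin k → H} (hx : Orthonormal ℂ x)
    (a : EuclideanSpace ℂ (Fin k)) : ‖euclideanCombination x a‖ = ‖a‖ := by
  rw [norm_eq_sqrt_re_inner (𝕜 := ℂ), hx.inner_euclideanCombination,
    ← norm_eq_sqrt_re_inner]

theorem Orthonormal.euclideanCombination_comp {ι : Type*} {x : Fin k → H} (hx : Orthonormal ℂ x)
    {b : ι → EuclideanSpace ℂ (Fin k)} (hb : Orthonormal ℂ b) :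
    Orthonormal ℂ fun l => euclideanCombination x (b l) :=
  ⟨fun i => by rw [hx.norm_euclideanCombination, hb.1], fun i j hij => by
    change inner ℂ (euclideanCombination x (b i)) (euclideanCombination x (b j)) = 0
    rw [hx.inner_euclideanCombination, hb.2 hij]⟩

/-- For orthonormal `x` these sums are traces of compressions to the span, hence independent of the
orthonormal basis. -/
theorem sum_quadTuple_euclideanCombination (A : Fin m → (H →L[ℂ] H)) (x : Fin k → H)
    (b : OrthonormalBasis (Fin k) ℂ (EuclideanSpace ℂ (Fin k))) :
    ∑ l, quadTuple A (euclideanCombination x (b l)) = ∑ l, quadTuple A (x l) := by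
  ext j
  simp only [Finset.sum_apply, quadTuple, euclideanCombination_apply, map_sum, map_smul,
    sum_inner, inner_sum, inner_smul_left, inner_smul_right]
  have h : ∀ i i' : Fin k, ∑ l, (starRingEnd ℂ) (b l i) * b l i' = if i = i' then 1 else 0 := by
    intro i i'
    have := b.sum_inner_mul_inner (EuclideanSpace.single i' 1) (EuclideanSpace.single i 1)
    simp only [EuclideanSpace.inner_single_left, EuclideanSpace.inner_single_right] at this
    simpa [mul_comm, Pi.single_apply, eq_comm] using this
  simp only [Finset.mul_sum]
  rw [Finset.sum_comm]
  refine Finset.sum_congr rfl fun i _ => ?_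
  rw [Finset.sum_comm]
  simp only [← mul_assoc, ← Finset.sum_mul]
  simp only [mul_comm (b _ _), h]
  simp

theorem exists_weak_limit [CompleteSpace H] {ι : Type*} (F : Ultrafilter ι) (f : ι → H) {C : ℝ}
    (hf : ∀ n, ‖f n‖ ≤ C) :
    ∃ u : H, ∀ h, Tendsto (fun n => inner ℂ (f n) h) F (𝓝 (inner ℂ u h)) := by
  let g : ι → WeakDual ℂ H := fun n => StrongDual.toWeakDual (InnerProductSpace.toDual ℂ H (f n))
  obtain ⟨φ, -, hφ⟩ := (WeakDual.isCompact_closedBall (𝕜 := ℂ) (E := H) 0 C).ultrafilter_le_nhds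
    (F.map g) (by
      rw [le_principal_iff]
      refine Filter.mem_map.2 (Filter.univ_mem' fun n => ?_)
      simpa [g] using hf n)
  refine ⟨(InnerProductSpace.toDual ℂ H).symm (WeakDual.toStrongDual φ), fun h => ?_⟩
  have := ((WeakDual.eval_continuous h).tendsto φ).comp (show Tendsto g F (𝓝 φ) from hφ)
  simpa [g, Function.comp_def] using this

theorem exists_tendsto_of_bounded {ι V : Type*} [NormedAddCommGroup V] [ProperSpace V]
    (F : Ultrafilter ι) (f : ι → V) {C : ℝ} (hf : ∀ n, ‖f n‖ ≤ C) : ∃ a, Tendsto f F (𝓝 a) := by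
  obtain ⟨a, -, ha⟩ := (isCompact_closedBall (0 : V) C).ultrafilter_le_nhds (F.map f) (by
    rw [le_principal_iff]
    exact Filter.mem_map.2 (Filter.univ_mem' fun n => by simpa using hf n))
  exact ⟨a, ha⟩

theorem Orthonormal.finCons {x : Fin k → H} (hx : Orthonormal ℂ x) {z : H} (hz : ‖z‖ = 1)
    (hxz : ∀ l, inner ℂ (x l) z = 0) : Orthonormal ℂ (Fin.cons z x : Fin (k + 1) → H) := by
  refine ⟨fun i => ?_, fun i j hij => ?_⟩
  · cases i using Fin.cases <;> simp [hz, hx.1]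
  · cases i using Fin.cases with
    | zero =>
      cases j using Fin.cases with
      | zero => exact absurd rfl hij
      | succ j => simpa using inner_eq_zero_symm.1 (hxz j)
    | succ i =>
      cases j using Fin.cases with
      | zero => simpa using hxz i
      | succ j => simpa using hx.2 (fun h => hij (congrArg Fin.succ h))

theorem add_mem_jointNumericalRange {A : Fin m → (H →L[ℂ] H)} {x : Fin k → H}
    (hx : Orthonormal ℂ x) {z : H} (hz : z ≠ 0) (hxz : ∀ l, inner ℂ (x l) z = 0) :
    ∑ l, quadTuple A (x l) + ((‖z‖ ^ 2)⁻¹ : ℝ) • quadTuple A z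
      ∈ jointNumericalRange (k + 1) A := by
  have hz' : ‖z‖ ≠ 0 := norm_ne_zero_iff.2 hz
  refine mem_jointNumericalRange.2 ⟨_, hx.finCons (z := ((‖z‖⁻¹ : ℝ) : ℂ) • z) ?_ ?_, ?_⟩
  · rw [norm_smul]
    simp [hz']
  · intro l
    rw [inner_smul_right, hxz, mul_zero]
  · rw [Fin.sum_univ_succ]
    simp [quadTuple_smul, add_comm]

/-- Adjoining an asymptotically orthogonal vector to orthonormal `k`-tuples leads, after
normalization, into the closure of the `(k+1)`-numerical range. -/
theorem add_mem_closure_jointNumericalRange {A : Fin m → (H →L[ℂ] H)} {ι : Type*} {F : Filter ι}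
    [F.NeBot] {x : ι → Fin k → H} (hx : ∀ n, Orthonormal ℂ (x n)) {z : ι → H}
    (hxz : ∀ l, Tendsto (fun n => inner ℂ (x n l) (z n)) F (𝓝 0)) {r : ℝ} (hr : 0 < r)
    (hzr : Tendsto (fun n => ‖z n‖ ^ 2) F (𝓝 r)) {s v : Fin m → ℂ}
    (hs : Tendsto (fun n => quadTuple A (z n)) F (𝓝 s))
    (hv : Tendsto (fun n => ∑ l, quadTuple A (x n l)) F (𝓝 v)) :
    v + r⁻¹ • s ∈ closure (jointNumericalRange (k + 1) A) := by
  -- The projection of `z n` onto the span of `x n`; it tends to zero, so removing it changes no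
  -- limit.
  set d : ι → H := fun n => ∑ l, inner ℂ (x n l) (z n) • x n l with hd
  have hd0 : Tendsto d F (𝓝 0) := by
    rw [tendsto_zero_iff_norm_tendsto_zero]
    refine squeeze_zero (g := fun n => ∑ l, ‖inner ℂ (x n l) (z n)‖) (fun n => norm_nonneg _)
      (fun n => (norm_sum_le _ _).trans_eq ?_) ?_
    · simp [norm_smul, (hx n).1]
    · simpa using tendsto_finsetSum Finset.univ fun l _ => (hxz l).norm
  have hzn : Tendsto (fun n => ‖z n‖) F (𝓝 √r) := by
    simpa using hzr.sqrt
  have hbdd : ∀ j, Tendsto (fun n => inner ℂ (z n - d n) (A j (z n - d n)) -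
      inner ℂ (z n) (A j (z n))) F (𝓝 0) := by
    intro j
    have hdn : Tendsto (fun n => ‖d n‖) F (𝓝 0) := by simpa using hd0.norm
    have hlim : Tendsto (fun n => ‖A j‖ * (‖z n‖ * ‖d n‖ + ‖d n‖ * ‖z n‖ + ‖d n‖ * ‖d n‖)) F
        (𝓝 0) := by
      simpa using (((hzn.mul hdn).add (hdn.mul hzn)).add (hdn.mul hdn)).const_mul ‖A j‖
    refine squeeze_zero_norm (fun n => ?_) hlim
    have hb : ∀ a b : H, ‖inner ℂ a (A j b)‖ ≤ ‖A j‖ * (‖a‖ * ‖b‖) := fun a b =>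
      calc _ ≤ ‖a‖ * (‖A j‖ * ‖b‖) :=
            (norm_inner_le_norm _ _).trans (by gcongr; exact (A j).le_opNorm b)
        _ = _ := by ring
    have : inner ℂ (z n - d n) (A j (z n - d n)) - inner ℂ (z n) (A j (z n)) =
        -inner ℂ (z n) (A j (d n)) - inner ℂ (d n) (A j (z n)) + inner ℂ (d n) (A j (d n)) := by
      simp only [map_sub, inner_sub_left, inner_sub_right]
      ring
    rw [this]
    refine (norm_add_le _ _).trans ((add_le_add_left (norm_sub_le _ _) _).trans ?_)
    rw [norm_neg, mul_add, mul_add]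
    gcongr <;> exact hb _ _
  have hs' : Tendsto (fun n => quadTuple A (z n - d n)) F (𝓝 s) := by
    rw [tendsto_pi_nhds] at hs ⊢
    intro j
    simpa [quadTuple] using (hbdd j).add (hs j)
  have hn' : Tendsto (fun n => ‖z n - d n‖ ^ 2) F (𝓝 r) := by
    have h1 : Tendsto (fun n => ‖z n - d n‖ - ‖z n‖) F (𝓝 0) :=
      squeeze_zero_norm (a := fun n => ‖d n‖)
        (fun n => (abs_norm_sub_norm_le _ _).trans_eq (by simp)) (by simpa using hd0.norm)
    have h2 := (h1.add hzn).pow 2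
    simpa [Real.sq_sqrt hr.le] using h2
  refine mem_closure_of_tendsto (b := F) (hv.add ((hn'.inv₀ hr.ne').smul hs')) ?_
  filter_upwards [hn'.eventually_ne hr.ne'] with n hn
  refine add_mem_jointNumericalRange (hx n) (fun h => hn (by simp [h])) fun l => ?_
  rw [inner_sub_right, hd, (hx n).inner_right_fintype, sub_self]


/-- The `k` orthogonality conditions have a unit solution `y` in the `(k + 1)`-dimensional span of
`x`; completing `y` to an orthonormal basis of that span preserves the trace. -/
theorem exists_orthogonal_sub_mem_jointNumericalRange (A : Fin m → (H →L[ℂ] H))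
    {x : Fin (k + 1) → H} (hx : Orthonormal ℂ x) (u : Fin k → H) :
    ∃ y : H, ‖y‖ = 1 ∧ (∀ l, inner ℂ (u l) y = 0) ∧
      ∑ l, quadTuple A (x l) - quadTuple A y ∈ jointNumericalRange k A := by
  let f : EuclideanSpace ℂ (Fin (k + 1)) →ₗ[ℂ] (Fin k → ℂ) :=
    LinearMap.pi fun l => (innerₛₗ ℂ (u l)) ∘ₗ euclideanCombination x
  obtain ⟨a, ha, ha0⟩ := (Submodule.ne_bot_iff _).1
    (LinearMap.ker_ne_bot_of_finrank_lt (f := f) (by simp))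
  have ha' : ‖a‖ ≠ 0 := norm_ne_zero_iff.2 ha0
  set c : EuclideanSpace ℂ (Fin (k + 1)) := ((‖a‖⁻¹ : ℝ) : ℂ) • a with hc
  have hc1 : ‖c‖ = 1 := by
    rw [hc, norm_smul]
    simp [ha']
  have hfc : f c = 0 := by
    rw [hc, map_smul, LinearMap.mem_ker.1 ha, smul_zero]
  obtain ⟨b, hb⟩ := Orthonormal.exists_orthonormalBasis_extension_of_card_eq (𝕜 := ℂ)
    (E := EuclideanSpace ℂ (Fin (k + 1))) (ι := Fin (k + 1)) (v := fun _ => c) (s := {0})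
    (by simp) ⟨fun _ => hc1, fun i j hij => absurd (Subsingleton.elim i j) hij⟩
  have hb0 : b 0 = c := hb 0 rfl
  have hob := hx.euclideanCombination_comp b.orthonormal
  refine ⟨euclideanCombination x c, by rw [hx.norm_euclideanCombination, hc1],
    fun l => congrFun hfc l, ?_⟩
  rw [← sum_quadTuple_euclideanCombination A x b, Fin.sum_univ_succ, hb0, add_sub_cancel_left]
  exact mem_jointNumericalRange.2 ⟨_, hob.comp _ (Fin.succ_injective k), rfl⟩

/-- An eigenbasis of `T* T` works. -/
theorem exists_orthonormalBasis_pairwise_orthogonal [CompleteSpace H]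
    (T : EuclideanSpace ℂ (Fin k) →ₗ[ℂ] H) :
    ∃ b : OrthonormalBasis (Fin k) ℂ (EuclideanSpace ℂ (Fin k)),
      Pairwise fun i j => inner ℂ (T (b i)) (T (b j)) = 0 := by
  let T' := LinearMap.toContinuousLinearMap T
  let G := (ContinuousLinearMap.adjoint T').comp T'
  have hG : (G : EuclideanSpace ℂ (Fin k) →ₗ[ℂ] EuclideanSpace ℂ (Fin k)).IsSymmetric := by
    intro a b
    simp [G, ContinuousLinearMap.adjoint_inner_left, ContinuousLinearMap.adjoint_inner_right]
  refine ⟨hG.eigenvectorBasis (by simp), fun i j hij => ?_⟩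
  set b := hG.eigenvectorBasis (n := k) (by simp) with hb
  have h := ContinuousLinearMap.adjoint_inner_right T' (b i) (T' (b j))
  change _ = inner ℂ (T (b i)) (T (b j)) at h
  rw [← h]
  have h2 : (ContinuousLinearMap.adjoint T') (T' (b j)) =
      (hG.eigenvalues (by simp) j : ℂ) • b j := hG.apply_eigenvectorBasis (by simp) j
  rw [h2, inner_smul_right, b.orthonormal.2 hij, mul_zero]

theorem norm_quadTuple_le (A : Fin m → (H →L[ℂ] H)) {x : H} (hx : ‖x‖ = 1) :
    ‖quadTuple A x‖ ≤ ‖A‖ := by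
  refine (pi_norm_le_iff_of_nonneg (norm_nonneg _)).2 fun j => ?_
  calc ‖inner ℂ x (A j x)‖ ≤ ‖x‖ * (‖A j‖ * ‖x‖) :=
        (norm_inner_le_norm _ _).trans (by gcongr; exact (A j).le_opNorm x)
    _ ≤ ‖A‖ := by simpa [hx] using norm_le_pi_norm A j

theorem isBounded_jointNumericalRange (A : Fin m → (H →L[ℂ] H)) :
    Bornology.IsBounded (jointNumericalRange k A) := by
  refine (Metric.isBounded_closedBall (x := 0) (r := k * ‖A‖)).subset fun a ha => ?_
  obtain ⟨x, hx, rfl⟩ := mem_jointNumericalRange.1 ha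
  rw [mem_closedBall_zero_iff]
  refine (norm_sum_le_of_le _ fun l _ => norm_quadTuple_le A (hx.1 l)).trans ?_
  simp

theorem tendsto_norm_sub_weak_limit_sq {ι : Type*} {F : Filter ι} {x : ι → H} {u : H}
    (hx : ∀ n, ‖x n‖ = 1)
    (hu : ∀ h, Tendsto (fun n => inner ℂ (x n) h) F (𝓝 (inner ℂ u h))) :
    Tendsto (fun n => ‖x n - u‖ ^ 2) F (𝓝 (1 - ‖u‖ ^ 2)) := by
  have h1 := (Complex.continuous_re.tendsto _).comp (hu u)
  have h2 := ((h1.const_mul 2).const_sub 1).add_const (‖u‖ ^ 2)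
  have h3 : (inner ℂ u u).re = ‖u‖ ^ 2 := inner_self_eq_norm_sq (𝕜 := ℂ) u
  convert h2 using 1
  · ext n
    rw [norm_sub_sq (𝕜 := ℂ), hx]
    simp
  · rw [h3]
    congr 1
    ring

variable [CompleteSpace H]

theorem tendsto_quadTuple_sub_weak_limit {ι : Type*} {F : Filter ι} {x : ι → H} {u : H}
    (A : Fin m → (H →L[ℂ] H))
    (hu : ∀ h, Tendsto (fun n => inner ℂ (x n) h) F (𝓝 (inner ℂ u h))) {s : Fin m → ℂ}
    (hs : Tendsto (fun n => quadTuple A (x n)) F (𝓝 s)) :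
    Tendsto (fun n => quadTuple A (x n - u)) F (𝓝 (s - quadTuple A u)) := by
  rw [tendsto_pi_nhds] at hs ⊢
  intro j
  have h1 := hu (A j u)
  have h2 : Tendsto (fun n => inner ℂ u (A j (x n))) F (𝓝 (inner ℂ u (A j u))) := by
    have := (continuous_star.tendsto _).comp (hu (ContinuousLinearMap.adjoint (A j) u))
    simpa [Function.comp_def, ContinuousLinearMap.adjoint_inner_left] using this
  have := (((hs j).sub h1).sub h2).add_const (inner ℂ u (A j u))
  simp only [quadTuple, Pi.sub_apply, map_sub, inner_sub_left, inner_sub_right] at this ⊢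
  convert this using 2 <;> ring

/-! ### Extreme points and closedness of the hull -/

theorem mem_or_exists_of_mem_extremePoints {A : Fin m → (H →L[ℂ] H)} {v : Fin m → ℂ}
    (hv : v ∈ (convexHull ℝ (closure (jointNumericalRange (k + 1) A))).extremePoints ℝ) :
    v ∈ jointNumericalRange (k + 1) A ∨ ∃ (e : Fin m → ℂ) (u : Fin (k + 1) → H),
      v + e ∈ closure (jointNumericalRange (k + 2) A) ∧
      ∀ y : H, ‖y‖ = 1 → (∀ l, inner ℂ (u l) y = 0) →
        v - e + quadTuple A y ∈ closure (jointNumericalRange (k + 1) A) := by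
  have hvc := extremePoints_convexHull_subset hv
  rw [mem_closure_iff_comap_neBot] at hvc
  set F := Ultrafilter.of (comap ((↑) : jointNumericalRange (k + 1) A → _) (𝓝 v)) with hF
  have hFv : Tendsto ((↑) : jointNumericalRange (k + 1) A → _) F (𝓝 v) :=
    tendsto_comap.mono_left (Ultrafilter.of_le _)
  choose x₀ hx₀ hx₀s using fun a : jointNumericalRange (k + 1) A => mem_jointNumericalRange.1 a.2
  choose w hw using fun i => exists_weak_limit F (fun n => x₀ n i) (C := 1)
    fun n => ((hx₀ n).1 i).le
  obtain ⟨b, hb⟩ := exists_orthonormalBasis_pairwise_orthogonal (euclideanCombination w)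
  set x := fun n l => euclideanCombination (x₀ n) (b l) with hxdef
  have hx : ∀ n, Orthonormal ℂ (x n) := fun n => (hx₀ n).euclideanCombination_comp b.orthonormal
  set u := fun l => euclideanCombination w (b l) with hudef
  have hu : ∀ l h, Tendsto (fun n => inner ℂ (x n l) h) F (𝓝 (inner ℂ (u l) h)) := by
    intro l h
    simp only [hxdef, hudef, euclideanCombination_apply, sum_inner, inner_smul_left]
    exact tendsto_finsetSum _ fun i _ => (hw i h).const_mul _
  have hxv : Tendsto (fun n => ∑ l, quadTuple A (x n l)) F (𝓝 v) := by
    refine hFv.congr fun n => ?_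
    rw [sum_quadTuple_euclideanCombination, hx₀s]
  choose s hs using fun l => exists_tendsto_of_bounded F (fun n => quadTuple A (x n l))
    fun n => norm_quadTuple_le A ((hx n).1 l)
  have hvs : v = ∑ l, s l := tendsto_nhds_unique hxv (tendsto_finsetSum _ fun l _ => hs l)
  have hnorm := fun l => tendsto_norm_sub_weak_limit_sq (fun n => (hx n).1 l) (hu l)
  have hu1 : ∀ l, ‖u l‖ ^ 2 ≤ 1 := fun l =>
    sub_nonneg.1 (ge_of_tendsto' (hnorm l) fun n => sq_nonneg _)
  -- Weak convergence of unit vectors to a unit vector is strong.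
  by_cases hall : ∀ l, ‖u l‖ ^ 2 = 1
  · left
    refine mem_jointNumericalRange.2 ⟨u, ⟨fun l => ?_, hb⟩, ?_⟩
    · nlinarith [hall l, norm_nonneg (u l)]
    · rw [hvs]
      refine Finset.sum_congr rfl fun l _ => tendsto_nhds_unique ?_ (hs l)
      refine ((continuous_quadTuple A).tendsto _).comp ?_
      rw [tendsto_iff_norm_sub_tendsto_zero]
      have := (hnorm l).sqrt
      simpa [hall l] using this
  right
  push Not at hall
  obtain ⟨l, hl⟩ := hall
  set p : ℝ := ‖u l‖ ^ 2 with hp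
  have hp1 : p < 1 := lt_of_le_of_ne (hu1 l) hl
  set r : Fin m → ℂ := ∑ i, s (l.succAbove i) with hr
  have hvr : v = s l + r := by rw [hvs, Fin.sum_univ_succAbove _ l]
  set e : Fin m → ℂ := (1 - p)⁻¹ • (s l - quadTuple A (u l)) with he
  have hx' : ∀ n, Orthonormal ℂ fun i => x n (l.succAbove i) := fun n =>
    (hx n).comp _ Fin.succAbove_right_injective
  have hxr : Tendsto (fun n => ∑ i, quadTuple A (x n (l.succAbove i))) F (𝓝 r) :=
    tendsto_finsetSum _ fun i _ => hs _
  have hess : ∀ {K : ℕ} {t : Fin K → H}, Orthonormal ℂ t →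
      ∑ i, quadTuple A (t i) + e ∈ closure (jointNumericalRange (K + 1) A) := by
    intro K t ht
    refine add_mem_closure_jointNumericalRange (F := F) (x := fun _ => t) (fun _ => ht)
      (z := fun n => x n l - u l) (fun i => ?_) (sub_pos.2 hp1) (hnorm l)
      (tendsto_quadTuple_sub_weak_limit A (hu l) (hs l)) tendsto_const_nhds
    have := (continuous_star.tendsto _).comp ((hu l (t i)).sub_const (inner ℂ (u l) (t i)))
    simpa [Function.comp_def, inner_sub_right] using this
  have hre : r + e ∈ closure (jointNumericalRange (k + 1) A) :=
    isClosed_closure.mem_of_tendsto (hxr.add_const e) (Eventually.of_forall fun n => hess (hx' n))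
  have hve : v + e ∈ closure (jointNumericalRange (k + 2) A) :=
    isClosed_closure.mem_of_tendsto (hxv.add_const e) (Eventually.of_forall fun n => hess (hx n))
  have hrep : ∀ h : H, h ≠ 0 → (∀ i, inner ℂ (u (l.succAbove i)) h = 0) →
      r + (‖h‖ ^ 2)⁻¹ • quadTuple A h ∈ closure (jointNumericalRange (k + 1) A) := by
    intro h hh huh
    refine add_mem_closure_jointNumericalRange hx' (z := fun _ => h) (fun i => ?_)
      (by positivity) tendsto_const_nhds tendsto_const_nhds hxr
    simpa [huh i] using hu (l.succAbove i) h
  -- `v` equals `p • (r + q (u l) / p) + (1 - p) • (r + e)`, with both points in the closure, so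
  -- extremality applies when `p > 0`.
  have hrev : r + e = v := by
    by_cases hul : u l = 0
    · have hp0 : p = 0 := by simp [hp, hul]
      have : quadTuple A (0 : H) = 0 := by ext; simp [quadTuple]
      rw [he, hul, hp0, this, hvr]
      simp [add_comm]
    · have hp0 : 0 < p := by positivity
      have h1 := hrep (u l) hul fun i => hb (Fin.succAbove_ne l i)
      refine ((mem_extremePoints.1 hv).2 _ (subset_convexHull ℝ _ h1) _
        (subset_convexHull ℝ _ hre) ⟨p, 1 - p, hp0, sub_pos.2 hp1, by ring, ?_⟩).2
      rw [smul_add, smul_add, he, ← hp, smul_inv_smul₀ hp0.ne',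
        smul_inv_smul₀ (sub_pos.2 hp1).ne', hvr, sub_smul, one_smul]
      abel
  refine ⟨e, u, hve, fun y hy huy => ?_⟩
  rw [← hrev, add_sub_cancel_right]
  simpa [hy] using hrep y (norm_ne_zero_iff.1 (by simp [hy])) fun i => huy _

theorem isClosed_convexHull_jointNumericalRange {A : Fin m → (H →L[ℂ] H)}
    (h : IsClosed (convexHull ℝ (jointNumericalRange (k + 2) A))) :
    IsClosed (convexHull ℝ (jointNumericalRange (k + 1) A)) := by
  set W := jointNumericalRange (k + 1) A with hW
  have hWc : IsCompact (convexHull ℝ (closure W)) :=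
    (isBounded_jointNumericalRange A).isCompact_closure.convexHull_of_finiteDimensional
  suffices heq : convexHull ℝ (closure W) ⊆ convexHull ℝ W by
    rw [← heq.antisymm (convexHull_mono subset_closure)]
    exact hWc.isClosed
  refine (hWc.subset_convexHull_extremePoints (by fun_prop) strictConvexOn_sum_norm_sq).trans
    (convexHull_min (fun v hv => ?_) (convex_convexHull ℝ _))
  rcases mem_or_exists_of_mem_extremePoints hv with hvW | ⟨e, u, hve, hy⟩
  · exact subset_convexHull ℝ _ hvW
  replace hve := closure_minimal (subset_convexHull ℝ _) h hve
  have key : convexHull ℝ (jointNumericalRange (k + 2) A) ⊆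
      {w | ∃ d ∈ convexHull ℝ W, w - d + (v - e) ∈ convexHull ℝ (closure W)} := by
    refine convexHull_min (fun w hw => ?_) ?_
    · obtain ⟨x, hx, rfl⟩ := mem_jointNumericalRange.1 hw
      obtain ⟨y, hy1, huy, hmem⟩ := exists_orthogonal_sub_mem_jointNumericalRange A hx u
      refine ⟨_, subset_convexHull ℝ _ hmem, ?_⟩
      rw [sub_sub_cancel, add_comm]
      exact subset_convexHull ℝ _ (hy y hy1 huy)
    · rintro w₁ ⟨d₁, hd₁, h₁⟩ w₂ ⟨d₂, hd₂, h₂⟩ a b ha hb hab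
      refine ⟨a • d₁ + b • d₂, convex_convexHull ℝ _ hd₁ hd₂ ha hb hab, ?_⟩
      convert convex_convexHull ℝ _ h₁ h₂ ha hb hab using 1
      obtain rfl : b = 1 - a := by linarith
      module
  obtain ⟨d, hd, hdv⟩ := key hve
  have := ((mem_extremePoints.1 hv).2 _ (convexHull_mono subset_closure hd) _ hdv
    ⟨1 / 2, 1 / 2, by norm_num, by norm_num, by norm_num, by module⟩).1
  exact this ▸ hd

end

/-! ### Finite dimension, and convexity for at most three operators -/

section
variable {H : Type*} [NormedAddCommGroup H] [InnerProductSpace ℂ H] {m k : ℕ}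

theorem isClosed_jointNumericalRange_of_finiteDimensional [FiniteDimensional ℂ H]
    (A : Fin m → (H →L[ℂ] H)) : IsClosed (jointNumericalRange k A) := by
  have : ProperSpace H := FiniteDimensional.proper ℂ H
  have hc : IsCompact {x : Fin k → H | Orthonormal ℂ x} := by
    refine Metric.isCompact_of_isClosed_isBounded ?_ ?_
    · have : {x : Fin k → H | Orthonormal ℂ x} = (⋂ i, {x | ‖x i‖ = 1}) ∩
          ⋂ i, ⋂ j, ⋂ (_ : i ≠ j), {x | inner ℂ (x i) (x j) = 0} := by
        ext x
        simp [Orthonormal, Pairwise]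
      rw [this]
      refine (isClosed_iInter fun i => isClosed_eq (by fun_prop) (by fun_prop)).inter
        (isClosed_iInter fun i => isClosed_iInter fun j => isClosed_iInter fun _ =>
          isClosed_eq (by fun_prop) (by fun_prop))
    · refine (Metric.isBounded_closedBall (x := 0) (r := 1)).subset fun x hx => ?_
      rw [mem_closedBall_zero_iff, pi_norm_le_iff_of_nonneg zero_le_one]
      exact fun i => (hx.1 i).le
  have : jointNumericalRange k A =
      (fun x : Fin k → H => ∑ l, quadTuple A (x l)) '' {x | Orthonormal ℂ x} := by
    ext a
    exact mem_jointNumericalRange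
  rw [this]
  refine (hc.image ?_).isClosed
  have := continuous_quadTuple A
  fun_prop

theorem exists_orthonormal_of_not_finiteDimensional (h : ¬FiniteDimensional ℂ H) (n : ℕ) :
    ∃ z : Fin n → H, Orthonormal ℂ z := by
  have hr : (n : Cardinal) ≤ Module.rank ℂ H := by
    refine Cardinal.natCast_lt_aleph0.le.trans ?_
    rw [← not_lt, Module.rank_lt_aleph0_iff]
    exact h
  obtain ⟨f, hf⟩ := exists_linearIndependent_of_le_rank hr
  exact ⟨_, InnerProductSpace.gramSchmidtNormed_orthonormal hf⟩

theorem exists_orthonormal_mem_orthogonal (h : ¬FiniteDimensional ℂ H) (V : Submodule ℂ H)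
    [FiniteDimensional ℂ V] (n : ℕ) :
    ∃ z : Fin n → H, Orthonormal ℂ z ∧ ∀ i, z i ∈ Vᗮ := by
  have hV : ¬FiniteDimensional ℂ Vᗮ := by
    intro hV
    refine h (Module.finite_def.2 ?_)
    rw [← Submodule.sup_orthogonal_of_hasOrthogonalProjection (K := V)]
    exact (Submodule.fg_iff_finiteDimensional _).2 inferInstance
  obtain ⟨z, hz⟩ := exists_orthonormal_of_not_finiteDimensional hV n
  exact ⟨fun i => z i, hz.comp_linearIsometry Vᗮ.subtypeₗᵢ, fun i => (z i).2⟩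

theorem Complex.exists_sub_eq_and_conj_mul_eq {a b : ℝ} (ha : 0 < a) (hb : 0 < b) (s : ℝ)
    (ζ : ℂ) : ∃ α β : ℂ, b * ‖α‖ ^ 2 - a * ‖β‖ ^ 2 = s ∧ (starRingEnd ℂ) α * β = ζ := by
  rcases eq_or_ne ζ 0 with rfl | hζ
  · rcases le_total 0 s with hs | hs
    · refine ⟨(√(s / b) : ℝ), 0, ?_, by simp⟩
      rw [Complex.norm_real, Real.norm_eq_abs, sq_abs, Real.sq_sqrt (by positivity)]
      simp
      field_simp
    · refine ⟨0, (√(-s / a) : ℝ), ?_, by simp⟩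
      rw [Complex.norm_real, Real.norm_eq_abs, sq_abs,
        Real.sq_sqrt (div_nonneg (by linarith) ha.le)]
      simp
      field_simp
  · have hζ' : 0 < ‖ζ‖ := norm_pos_iff.2 hζ
    set R := √(s ^ 2 + 4 * a * b * ‖ζ‖ ^ 2) with hR
    have hR2 : R ^ 2 = s ^ 2 + 4 * a * b * ‖ζ‖ ^ 2 := Real.sq_sqrt (by positivity)
    have hRs : |s| < R := by
      rw [hR, Real.lt_sqrt (abs_nonneg s), sq_abs]
      have : 0 < 4 * a * b * ‖ζ‖ ^ 2 := by positivity
      linarith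
    -- `X = ‖α‖ ^ 2` is the positive root of `b X² - s X - a ‖ζ‖² = 0`, obtained by eliminating `β`.
    set X := (s + R) / (2 * b) with hX
    have hX0 : 0 < X := div_pos (by linarith [(abs_lt.1 hRs).1]) (by positivity)
    have hXeq : b * X ^ 2 - a * ‖ζ‖ ^ 2 = s * X := by
      rw [hX]
      field_simp
      nlinarith
    have hsq : √X ^ 2 = X := Real.sq_sqrt hX0.le
    have hne : ((√X : ℝ) : ℂ) ≠ 0 := by
      exact_mod_cast (Real.sqrt_pos.2 hX0).ne'
    refine ⟨(√X : ℝ), ζ / (√X : ℝ), ?_, ?_⟩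
    · rw [norm_div, div_pow, Complex.norm_real, Real.norm_eq_abs, sq_abs, hsq]
      field_simp
      linarith
    · rw [Complex.conj_ofReal]
      field_simp

variable [CompleteSpace H]

/-- For `w = αx + βy + γz`, the conditions `⟨w, A j w⟩ = τ j ‖w‖²` are real linear in `s = b|α|² -
a|β|²`, `ζ = conj α * β` and `g = |γ|²`. These span four real dimensions, so `m ≤ 3` equations have
a nonzero solution, and its sign can be chosen with `g ≥ 0`. -/
theorem exists_quadTuple_eq_combo {A : Fin m → (H →L[ℂ] H)} (hA : ∀ j, IsSelfAdjoint (A j))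
    (hm : m ≤ 3) {x y z : H} (hx : ‖x‖ = 1) (hy : ‖y‖ = 1) (hz : ‖z‖ = 1)
    (hxz : inner ℂ x z = 0) (hyz : inner ℂ y z = 0) (hAxz : ∀ j, inner ℂ (A j x) z = 0)
    (hAyz : ∀ j, inner ℂ (A j y) z = 0) {a b : ℝ} (ha : 0 ≤ a) (hb : 0 ≤ b) (hab : a + b = 1) :
    ∃ α β γ : ℂ, ‖α • x + β • y + γ • z‖ = 1 ∧
      quadTuple A (α • x + β • y + γ • z) = a • quadTuple A x + b • quadTuple A y := by
  by_cases hq : quadTuple A x = quadTuple A y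
  · exact ⟨1, 0, 0, by simpa using hx, by simp [← hq, ← add_smul, hab]⟩
  rcases ha.eq_or_lt with rfl | ha
  · obtain rfl : b = 1 := by linarith
    exact ⟨0, 1, 0, by simpa using hy, by simp⟩
  rcases hb.eq_or_lt with rfl | hb
  · obtain rfl : a = 1 := by linarith
    exact ⟨1, 0, 0, by simpa using hx, by simp⟩
  have hsym : ∀ j (v w : H), inner ℂ (A j v) w = inner ℂ v (A j w) :=
    fun j => (hA j).isSymmetric
  obtain ⟨Q, hQ⟩ : ∃ Q : Fin m → H → ℝ, ∀ j v, inner ℂ v (A j v) = (Q j v : ℂ) :=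
    ⟨fun j v => (inner ℂ v (A j v)).re, fun j v =>
      (Complex.conj_eq_iff_re.1 (by rw [inner_conj_symm, hsym])).symm⟩
  set τ : Fin m → ℝ := fun j => a * Q j x + b * Q j y with hτ
  set c : Fin m → ℂ := fun j => inner ℂ x (A j y) - τ j * inner ℂ x y with hc
  let L : ℝ × ℂ × ℝ →ₗ[ℝ] (Fin m → ℝ) :=
    { toFun := fun v j => (Q j x - Q j y) * v.1 + 2 * (v.2.1 * c j).re + (Q j z - τ j) * v.2.2
      map_add' := fun v w => by
        ext j
        simp
        ring
      map_smul' := fun t v => by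
        ext j
        simp
        ring }
  obtain ⟨v, hv, hv0⟩ := (Submodule.ne_bot_iff _).1
    (LinearMap.ker_ne_bot_of_finrank_lt (f := L) (by simp; omega))
  obtain ⟨⟨s, ζ, g⟩, hv, hv0, hg⟩ : ∃ v : ℝ × ℂ × ℝ, L v = 0 ∧ v ≠ 0 ∧ 0 ≤ v.2.2 := by
    rcases le_total 0 v.2.2 with h | h
    · exact ⟨v, hv, hv0, h⟩
    · exact ⟨-v, by rw [map_neg, LinearMap.mem_ker.1 hv, neg_zero], neg_ne_zero.2 hv0, by simpa⟩
  obtain ⟨α, β, hs, hζ⟩ := Complex.exists_sub_eq_and_conj_mul_eq ha hb s ζ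
  set γ : ℂ := ((√g : ℝ) : ℂ) with hγ
  have hγ2 : (starRingEnd ℂ) γ * γ = g := by
    rw [hγ, Complex.conj_ofReal, ← Complex.ofReal_mul, Real.mul_self_sqrt hg]
  set w := α • x + β • y + γ • z with hw
  have hzx := inner_eq_zero_symm.1 hxz
  have hzy := inner_eq_zero_symm.1 hyz
  -- If `w = 0`, then `γ = 0` and `α • x = -β • y`: either all coefficients vanish, or `x` and `y`
  -- have the same value.
  have hw0 : w ≠ 0 := by
    intro h0
    have hγ0 : γ = 0 := by
      have : inner ℂ z w = 0 := by rw [h0, inner_zero_right]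
      simpa [hw, inner_add_right, inner_smul_right, hzx, hzy, inner_self_eq_norm_sq_to_K, hz]
        using this
    have hsum : α • x + β • y = 0 := by simpa [hw, hγ0] using h0
    have hxy : α • x = (-β) • y := by rw [neg_smul, eq_neg_iff_add_eq_zero, hsum]
    have hαβ : ‖α‖ = ‖β‖ := by simpa [norm_smul, hx, hy] using congrArg norm hxy
    have hqq := congrArg (quadTuple A) hxy
    rw [quadTuple_smul, quadTuple_smul, norm_neg, hαβ] at hqq
    by_cases hβ : β = 0
    · have hα : α = 0 := by simpa [hβ] using hαβ
      have hg0 : g = 0 := by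
        rw [hγ0] at hγ2
        exact_mod_cast (by simpa using hγ2.symm : (g : ℂ) = 0)
      refine hv0 ?_
      rw [← hs, ← hζ, hα, hβ, hg0]
      simp
    · exact hq (smul_right_injective _ (pow_ne_zero 2 (norm_ne_zero_iff.2 hβ)) hqq)
  have hform : ∀ j, inner ℂ w (A j w) = (τ j : ℂ) * inner ℂ w w := by
    intro j
    have hLj : (Q j x - Q j y) * s + 2 * (ζ * c j).re + (Q j z - τ j) * g = 0 := congrFun hv j
    have hLC : ((Q j x - Q j y) * s + (ζ * c j + (starRingEnd ℂ) (ζ * c j)) +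
        (Q j z - τ j) * g : ℂ) = 0 := by
      rw [Complex.add_conj]
      exact_mod_cast hLj
    have hcc : (starRingEnd ℂ) (c j) = inner ℂ y (A j x) - τ j * inner ℂ y x := by
      simp only [hc, map_sub, map_mul, inner_conj_symm, Complex.conj_ofReal, hsym]
    rw [map_mul, hcc] at hLC
    have hsC : (b * ((starRingEnd ℂ) α * α) - a * ((starRingEnd ℂ) β * β) : ℂ) = s := by
      rw [Complex.conj_mul', Complex.conj_mul']
      exact_mod_cast hs
    have hxAz : inner ℂ x (A j z) = 0 := by rw [← hsym, hAxz]
    have hyAz : inner ℂ y (A j z) = 0 := by rw [← hsym, hAyz]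
    have hzAx : inner ℂ z (A j x) = 0 := inner_eq_zero_symm.1 (hAxz j)
    have hzAy : inner ℂ z (A j y) = 0 := inner_eq_zero_symm.1 (hAyz j)
    have hxx : inner ℂ x x = (1 : ℂ) := by simp [inner_self_eq_norm_sq_to_K, hx]
    have hyy : inner ℂ y y = (1 : ℂ) := by simp [inner_self_eq_norm_sq_to_K, hy]
    have hzz : inner ℂ z z = (1 : ℂ) := by simp [inner_self_eq_norm_sq_to_K, hz]
    simp only [hw, map_add, map_smul, inner_add_left, inner_add_right, inner_smul_left,
      inner_smul_right, hxAz, hyAz, hzAx, hzAy, hxx, hyy, hzz, hxz, hyz, hzx, hzy,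
      hQ]
    have habC : (a + b : ℂ) = 1 := by exact_mod_cast hab
    have hτC : (τ j : ℂ) = a * Q j x + b * Q j y := by simp [hτ]
    simp only [hc] at hLC
    obtain ha' : (a : ℂ) = 1 - b := by linear_combination habC
    rw [← hsC, ← hζ, ← hγ2] at hLC
    simp only [map_mul, Complex.conj_conj] at hLC
    rw [hτC, ha'] at hLC ⊢
    linear_combination hLC
  have hwn : ‖w‖ ≠ 0 := norm_ne_zero_iff.2 hw0
  have hscale : ((‖w‖⁻¹ : ℝ) : ℂ) • w = (((‖w‖⁻¹ : ℝ) : ℂ) * α) • x +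
      (((‖w‖⁻¹ : ℝ) : ℂ) * β) • y + (((‖w‖⁻¹ : ℝ) : ℂ) * γ) • z := by
    rw [hw, smul_add, smul_add, smul_smul, smul_smul, smul_smul]
  refine ⟨((‖w‖⁻¹ : ℝ) : ℂ) * α, ((‖w‖⁻¹ : ℝ) : ℂ) * β, ((‖w‖⁻¹ : ℝ) : ℂ) * γ, ?_, ?_⟩ <;>
    rw [← hscale]
  · rw [norm_smul]
    simp [hwn]
  · rw [quadTuple_smul]
    ext j
    simp only [Pi.smul_apply, Pi.add_apply, quadTuple, hform j, Complex.real_smul]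
    rw [inner_self_eq_norm_sq_to_K, hQ, hQ]
    simp only [hτ]
    push_cast
    have : (‖w‖ : ℂ) ≠ 0 := by exact_mod_cast hwn
    simp
    field_simp

/-- Two orthonormal `k`-tuples can be rotated within their spans so that vectors with different
indices are orthogonal. -/
theorem exists_aligned_orthonormal (A : Fin m → (H →L[ℂ] H)) {x y : Fin k → H}
    (hx : Orthonormal ℂ x) (hy : Orthonormal ℂ y) :
    ∃ x' y' : Fin k → H, Orthonormal ℂ x' ∧ Orthonormal ℂ y' ∧
      (∀ i j, i ≠ j → inner ℂ (x' i) (y' j) = 0) ∧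
      ∑ l, quadTuple A (x' l) = ∑ l, quadTuple A (x l) ∧
      ∑ l, quadTuple A (y' l) = ∑ l, quadTuple A (y l) := by
  let Y := LinearMap.toContinuousLinearMap (euclideanCombination y)
  let M : EuclideanSpace ℂ (Fin k) →ₗ[ℂ] EuclideanSpace ℂ (Fin k) :=
    (ContinuousLinearMap.adjoint Y).toLinearMap ∘ₗ euclideanCombination x
  have hM : ∀ c d, inner ℂ c (M d) =
      inner ℂ (euclideanCombination y c) (euclideanCombination x d) := fun c d =>
    ContinuousLinearMap.adjoint_inner_right Y c _
  -- A singular value decomposition of `M`: `b` and `c` are its right and left singular bases.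
  obtain ⟨b, hb⟩ := exists_orthonormalBasis_pairwise_orthogonal M
  have hon : Orthonormal ℂ (Set.domRestrict {i | M (b i) ≠ 0}
      fun i => ((‖M (b i)‖⁻¹ : ℝ) : ℂ) • M (b i)) := by
    refine ⟨fun i => ?_, fun i j hij => ?_⟩
    · have : ‖M (b i)‖ ≠ 0 := norm_ne_zero_iff.2 i.2
      simp [norm_smul, this]
    · have : inner ℂ (M (b i)) (M (b j)) = 0 := hb (Subtype.coe_injective.ne hij)
      simp [inner_smul_left, inner_smul_right, this]
  obtain ⟨c, hc⟩ := hon.exists_orthonormalBasis_extension_of_card_eq (by simp)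
  refine ⟨_, _, hx.euclideanCombination_comp b.orthonormal,
    hy.euclideanCombination_comp c.orthonormal, fun i j hij => ?_,
    sum_quadTuple_euclideanCombination A x b, sum_quadTuple_euclideanCombination A y c⟩
  rw [inner_eq_zero_symm, ← hM]
  by_cases hi : M (b i) = 0
  · rw [hi, inner_zero_right]
  · have hn : ((‖M (b i)‖⁻¹ : ℝ) : ℂ) ≠ 0 := by
      exact_mod_cast inv_ne_zero (norm_ne_zero_iff.2 hi)
    have h := c.orthonormal.2 hij.symm
    simp only [hc i hi, inner_smul_right] at h
    exact (mul_eq_zero.1 h).resolve_left hn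

theorem convex_jointNumericalRange (hH : ¬FiniteDimensional ℂ H) {A : Fin m → (H →L[ℂ] H)}
    (hA : ∀ j, IsSelfAdjoint (A j)) (hm : m ≤ 3) : Convex ℝ (jointNumericalRange k A) := by
  intro p hp q hq a b ha hb hab
  obtain ⟨x₀, hx₀, rfl⟩ := mem_jointNumericalRange.1 hp
  obtain ⟨y₀, hy₀, rfl⟩ := mem_jointNumericalRange.1 hq
  obtain ⟨x, y, hx, hy, hxy, hxs, hys⟩ := exists_aligned_orthonormal A hx₀ hy₀
  rw [← hxs, ← hys]
  -- Taking `z` orthogonal to `S` removes all cross terms with `z`; alignment then makes the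
  -- combinations for different indices orthogonal.
  set S : Set H := (Set.range x ∪ Set.range y) ∪
    ((Set.range fun p : Fin m × Fin k => A p.1 (x p.2)) ∪
      Set.range fun p : Fin m × Fin k => A p.1 (y p.2)) with hS
  have hSf : S.Finite := ((Set.finite_range _).union (Set.finite_range _)).union
    ((Set.finite_range _).union (Set.finite_range _))
  have := FiniteDimensional.span_of_finite ℂ hSf
  obtain ⟨z, hz, hzS⟩ := exists_orthonormal_mem_orthogonal hH (Submodule.span ℂ S) k
  have hSz : ∀ h ∈ S, ∀ i, inner ℂ h (z i) = 0 := fun h hh i =>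
    (Submodule.mem_orthogonal _ _).1 (hzS i) h (Submodule.subset_span hh)
  have hxz : ∀ i j, inner ℂ (x i) (z j) = 0 := fun i => hSz _ (.inl (.inl ⟨i, rfl⟩))
  have hyz : ∀ i j, inner ℂ (y i) (z j) = 0 := fun i => hSz _ (.inl (.inr ⟨i, rfl⟩))
  choose α β γ hn hw using fun i => exists_quadTuple_eq_combo hA hm (hx.1 i) (hy.1 i) (hz.1 i)
    (hxz i i) (hyz i i) (fun j => hSz _ (.inr (.inl ⟨(j, i), rfl⟩)) i)
    (fun j => hSz _ (.inr (.inr ⟨(j, i), rfl⟩)) i) ha hb hab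
  refine mem_jointNumericalRange.2 ⟨_, ⟨hn, fun i j hij => ?_⟩, ?_⟩
  · have h1 := hx.2 hij
    have h2 := hy.2 hij
    have h3 := hz.2 hij
    have h4 := inner_eq_zero_symm.1 (hxy j i hij.symm)
    simp only at h1 h2 h3
    simp [inner_add_left, inner_add_right, inner_smul_left, inner_smul_right, h1, h2, h3, h4,
      hxy i j hij, hxz, hyz, inner_eq_zero_symm.1 (hxz _ _), inner_eq_zero_symm.1 (hyz _ _)]
  · simp only [hw, Finset.sum_add_distrib, Finset.smul_sum]

end

theorem mainTheorem3 {H : Type*} [NormedAddCommGroup H] [InnerProductSpace ℂ H] [CompleteSpace H]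
    {m : ℕ} (A : Fin m → (H →L[ℂ] H)) (hA : ∀ j, IsSelfAdjoint (A j)) (k : ℕ) (hk : 1 ≤ k) :
    (m ≤ 3 → IsClosed (jointNumericalRange (k + 1) A) → IsClosed (jointNumericalRange k A)) ∧
    (IsClosed (jointNumericalRange (k + 1) A) ∨
        IsClosed (convexHull ℝ (jointNumericalRange (k + 1) A)) →
      IsClosed (convexHull ℝ (jointNumericalRange k A))) := by
  obtain ⟨k, rfl⟩ := Nat.exists_eq_add_of_le' hk
  have hconv : IsClosed (jointNumericalRange (k + 1 + 1) A) →
      IsClosed (convexHull ℝ (jointNumericalRange (k + 1 + 1) A)) := fun h =>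
    (Metric.isCompact_of_isClosed_isBounded h
      (isBounded_jointNumericalRange A)).convexHull_of_finiteDimensional.isClosed
  refine ⟨fun hm h => ?_, fun h => isClosed_convexHull_jointNumericalRange (h.elim hconv id)⟩
  by_cases hH : FiniteDimensional ℂ H
  · exact isClosed_jointNumericalRange_of_finiteDimensional A
  · rw [← (convex_jointNumericalRange hH hA hm).convexHull_eq]
    exact isClosed_convexHull_jointNumericalRange (hconv h)
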